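/- Conventions. A system $\mathbf X=(X,\mu,T)$ is a probability space $(X,\mu)$ with an invertible (bimeasurable) map $T:X\to X$ such that $\mu(T^{-1}D)=\mu(D)$ for every measurable $D\subseteq X$; it is nontrivial if some measurable $D\subseteq X$ has $0<\mu(D)<1$. A set $S\subseteq\mathbb Z$ is a set of recurrence if for every system $(Y,\nu,R)$ and every measurable $D\subseteq Y$ with $\nu(D)>0$ there is $n\in S$ with $\nu(D\cap R^nD)>0$. A set $S\subseteq\mathbb Z$ is a set of rigidity for $\mathbf X=(X,\mu,T)$ if $S$ is infinite, $\mathbf X$ is nontrivial and ergodic, and for every measurable $D\subseteq X$ and every $\varepsilon>0$ the set $\{n\in S:\mu(D\,\triangle\,T^nD)>\varepsilon\}$ is finite. The system $\mathbf X$ is a rigid-recurrence system if there is a set of rigidity $S$ for $\mathbf X$ such that $S+n$ is a set of recurrence for every $n\in\mathbb Z$. For measurable $D\subseteq X$ and $c>0$ put $R_c(D)=\{n\in\mathbb Z:\mu(D\cap T^nD)>c\}$. For $B\subseteq\mathbb Z$, $d^*(B)=\lim_{N\to\infty}\sup_{M\in\mathbb Z}\frac{|B\cap[M,M+N-1]|}{N}$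 is the upper Banach density and $B-B=\{a-b:a,b\in B\}$. Proposition. Let $\mathbf X=(X,\mu,T)$ be a nontrivial rigid-recurrence system and let $D\subseteq X$ be a measurable set with $D\cap TD=\varnothing$. Then for every $c>0$ there are no $n_0\in\mathbb Z$ and $B\subseteq\mathbb Z$ with $d^*(B)>0$ such that $n_0+B-B\subseteq R_c(D)$. -/

import Mathlib

open MeasureTheory Set Filter Topology
open scoped Pointwise symmDiff

/-- The image `Tⁿ D` of a set under the `n`-th (possibly negative) iterate of an invertible
bimeasurable map. -/
def iterImage {X : Type*} [MeasurableSpace X] (T : X ≃ᵐ X) (n : ℤ) (D : Set X) : Set X :=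
  ⇑((T.toEquiv : Equiv.Perm X) ^ n) '' D

/-- `(X, μ, T)` is an (invertible) measure preserving system: `μ` is a probability measure and
`T` is an invertible bimeasurable map preserving `μ`. -/
structure IsSystem {X : Type*} [MeasurableSpace X] (μ : Measure X) (T : X ≃ᵐ X) : Prop where
  isProbabilityMeasure : IsProbabilityMeasure μ
  measurePreserving : MeasurePreserving T μ μ

/-- The system is nontrivial: some measurable set has measure different from `0` and `1`, i.e. the
system is not isomorphic modulo null sets to a one-point system. -/
def IsNontrivialSystem {X : Type*} [MeasurableSpace X] (μ : Measure X) : Prop :=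
  ∃ D : Set X, MeasurableSet D ∧ 0 < μ D ∧ μ D < 1

/-- `S ⊆ ℤ` is a set of recurrence: for every measure preserving system and every measurable `D`
with `μ(D) > 0` there is `n ∈ S` with `μ(D ∩ Tⁿ D) > 0`.
(Systems on arbitrary types of the lowest universe are enough: with the coding map
`x ↦ (1_D(Tⁱ x))_i`, every pair `(system, D)` in any universe is a pullback of such a pair
living on `ℤ → Bool`, with the same measures `μ(D ∩ Tⁿ D)`.) -/
def IsSetOfRecurrence (S : Set ℤ) : Prop :=
  ∀ (Y : Type) [MeasurableSpace Y] (ν : Measure Y) (R : Y ≃ᵐ Y), IsSystem ν R →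
    ∀ D : Set Y, MeasurableSet D → 0 < ν D → ∃ n ∈ S, 0 < ν (D ∩ iterImage R n D)

/-- `S` is a set of rigidity for the system `(X, μ, T)`: `S` is infinite, the system is nontrivial
and ergodic, and for all measurable `D` and `ε > 0` only finitely many `n ∈ S` satisfy
`μ(D ∆ Tⁿ D) > ε`. -/
structure IsSetOfRigidityFor {X : Type*} [MeasurableSpace X] (S : Set ℤ) (μ : Measure X)
    (T : X ≃ᵐ X) : Prop where
  infinite : S.Infinite
  isSystem : IsSystem μ T
  nontrivial : IsNontrivialSystem μ
  ergodic : Ergodic T μ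
  rigid : ∀ D : Set X, MeasurableSet D → ∀ ε : ℝ, 0 < ε →
    {n : ℤ | n ∈ S ∧ ε < μ.real (D ∆ iterImage T n D)}.Finite

/-- A rigid-recurrence system: it has a set of rigidity all of whose translates are sets of
recurrence. -/
def IsRigidRecurrenceSystem {X : Type*} [MeasurableSpace X] (μ : Measure X) (T : X ≃ᵐ X) : Prop :=
  IsSystem μ T ∧ ∃ S : Set ℤ, IsSetOfRigidityFor S μ T ∧
    ∀ n : ℤ, IsSetOfRecurrence ((fun s => s + n) '' S)

/-- The `c`-popular recurrence set `R_c(D) = {n : μ(D ∩ Tⁿ D) > c}`. -/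
def popularRecurrenceSet {X : Type*} [MeasurableSpace X] (μ : Measure X) (T : X ≃ᵐ X)
    (c : ℝ) (D : Set X) : Set ℤ :=
  {n : ℤ | c < μ.real (D ∩ iterImage T n D)}

/-- `sup_{M ∈ ℤ} |A ∩ [M, M + N - 1]|`, a supremum of reals in `[0, N]`. -/
noncomputable def maxCount (A : Set ℤ) (N : ℕ) : ℝ :=
  ⨆ M : ℤ, ((A ∩ Icc M (M + N - 1)).ncard : ℝ)

/-- The upper Banach density `d*(A) = lim_{N → ∞} sup_M |A ∩ [M, M + N - 1]| / N`. It is written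
with `limsup`; `tendsto_upperBanachDensity` shows that it is a genuine limit. -/
noncomputable def upperBanachDensity (A : Set ℤ) : ℝ :=
  limsup (fun N : ℕ => maxCount A N / N) atTop

theorem ncard_inter_Icc_le (A : Set ℤ) (M : ℤ) (N : ℕ) :
    (A ∩ Icc M (M + N - 1)).ncard ≤ N := by
  calc (A ∩ Icc M (M + N - 1)).ncard ≤ (Icc M (M + N - 1)).ncard :=
        ncard_le_ncard inter_subset_right (finite_Icc _ _)
    _ = N := by
        rw [← Finset.coe_Icc, ncard_coe_finset, Int.card_Icc]; omega

theorem bddAbove_ncard (A : Set ℤ) (N : ℕ) :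
    BddAbove (range fun M : ℤ => ((A ∩ Icc M (M + N - 1)).ncard : ℝ)) :=
  ⟨N, by rintro _ ⟨M, rfl⟩; exact Nat.cast_le.2 (ncard_inter_Icc_le A M N)⟩

theorem maxCount_nonneg (A : Set ℤ) (N : ℕ) : 0 ≤ maxCount A N :=
  Real.iSup_nonneg fun _ => Nat.cast_nonneg _

theorem maxCount_subadditive (A : Set ℤ) : Subadditive (maxCount A) := by
  intro m n
  refine ciSup_le fun M => ?_
  have hsub : A ∩ Icc M (M + (m + n : ℕ) - 1) ⊆
      (A ∩ Icc M (M + m - 1)) ∪ (A ∩ Icc (M + m) (M + m + n - 1)) := by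
    rintro x ⟨hx, h1, h2⟩
    push_cast at h2
    by_cases h : x ≤ M + m - 1
    · exact Or.inl ⟨hx, h1, h⟩
    · exact Or.inr ⟨hx, by omega, by omega⟩
  have hcard : (A ∩ Icc M (M + (m + n : ℕ) - 1)).ncard ≤
      (A ∩ Icc M (M + m - 1)).ncard + (A ∩ Icc (M + m) (M + m + n - 1)).ncard :=
    (ncard_le_ncard hsub (((finite_Icc _ _).inter_of_right _).union
      ((finite_Icc _ _).inter_of_right _))).trans (ncard_union_le _ _)
  calc ((A ∩ Icc M (M + (m + n : ℕ) - 1)).ncard : ℝ)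
      ≤ (A ∩ Icc M (M + m - 1)).ncard + (A ∩ Icc (M + m) (M + m + n - 1)).ncard := by
        exact_mod_cast hcard
    _ ≤ maxCount A m + maxCount A n :=
        add_le_add (le_ciSup (bddAbove_ncard A m) M) (le_ciSup (bddAbove_ncard A n) (M + m))

/-- The limit defining the upper Banach density exists. -/
theorem tendsto_upperBanachDensity (A : Set ℤ) :
    Tendsto (fun N : ℕ => maxCount A N / N) atTop (𝓝 (upperBanachDensity A)) := by
  have h := (maxCount_subadditive A).tendsto_lim
    ⟨0, by rintro _ ⟨N, rfl⟩; exact div_nonneg (maxCount_nonneg A N) N.cast_nonneg⟩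
  rwa [upperBanachDensity, h.limsup_eq]

/-! ### Iterated images under a measure preserving equivalence -/

section IterImage

variable {X : Type*} [MeasurableSpace X]

/-! If `s` and `s₀` are rigidity times, then `T^(s + s₀)` nearly fixes `D`, so `T^(1 + s + s₀)`
carries `D` nearly onto `T D`, which is disjoint from `D`. Hence `1 + s + s₀` is not a popular
return time. To find such a time in `n₀ + B - B`, note that the translate `S + (1 - n₀ + s₀)` is a
set of recurrence, so it meets `B - B` by Furstenberg's correspondence
(`IsSetOfRecurrence.exists_mem_sub`).

The meeting point must come from some `s` outside the finite set of bad rigidity times. Passing to a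
residue class of `B` excludes every bad nonzero difference, but never the difference `0`. The extra
time `s₀` is chosen so that `0` does not come from a bad `s`. -/

theorem iterImage_add (T : X ≃ᵐ X) (m n : ℤ) (A : Set X) :
    iterImage T (m + n) A = iterImage T m (iterImage T n A) := by
  simp only [iterImage, zpow_add, Equiv.Perm.coe_mul, image_comp]

theorem iterImage_one (T : X ≃ᵐ X) (A : Set X) : iterImage T 1 A = T '' A := by
  simp [iterImage]

theorem iterImage_zero (T : X ≃ᵐ X) (A : Set X) : iterImage T 0 A = A := by
  simp [iterImage]

theorem measure_iterImage {μ : Measure X} {T : X ≃ᵐ X} (hT : MeasurePreserving T μ μ)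
    (n : ℤ) (A : Set X) : μ (iterImage T n A) = μ A := by
  have h1 : ∀ A : Set X, μ (iterImage T 1 A) = μ A := fun A => by
    rw [iterImage_one, MeasurableEquiv.image_eq_preimage_symm]
    exact (hT.symm T).measure_preimage_equiv A
  induction n using Int.induction_on with
  | zero => rw [iterImage_zero]
  | succ n ih => rw [add_comm, iterImage_add, h1, ih]
  | pred n ih =>
    rw [← ih, ← h1 (iterImage T (-n - 1) A), ← iterImage_add]
    congr 2
    ring

/-- `T^m` is an isometry for the pseudometric `μ (A ∆ B)`, so this is the triangle inequality
through `T^m A`. -/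
theorem measureReal_symmDiff_iterImage_add_le {μ : Measure X} [IsFiniteMeasure μ] {T : X ≃ᵐ X}
    (hT : MeasurePreserving T μ μ) (m n : ℤ) (A : Set X) :
    μ.real (A ∆ iterImage T (m + n) A) ≤
      μ.real (A ∆ iterImage T m A) + μ.real (A ∆ iterImage T n A) := by
  have h : iterImage T m A ∆ iterImage T m (iterImage T n A) =
      iterImage T m (A ∆ iterImage T n A) :=
    (image_symmDiff (Equiv.injective _) _ _).symm
  have h' : μ.real (A ∆ iterImage T n A) =
      μ.real (iterImage T m A ∆ iterImage T m (iterImage T n A)) := by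
    rw [h, measureReal_def, measureReal_def, measure_iterImage hT]
  rw [iterImage_add, h']
  exact (measureReal_mono (symmDiff_triangle _ _ _)).trans (measureReal_union_le _ _)

/-- If `D` and `T D` are disjoint, then `D` and `T¹⁺ⁿ D` overlap only as far as `Tⁿ` moves `D`. -/
theorem measureReal_inter_iterImage_one_add_le {μ : Measure X} [IsFiniteMeasure μ] {T : X ≃ᵐ X}
    (hT : MeasurePreserving T μ μ) {D : Set X} (hD : D ∩ T '' D = ∅) (n : ℤ) :
    μ.real (D ∩ iterImage T (1 + n) D) ≤ μ.real (D ∆ iterImage T n D) := by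
  have hsub : D ∩ iterImage T (1 + n) D ⊆ iterImage T 1 (D ∆ iterImage T n D) := by
    rw [iterImage_add, iterImage_one, iterImage_one]
    rintro _ ⟨hx, y, hy, rfl⟩
    refine ⟨y, Or.inr ⟨hy, fun hyD => ?_⟩, rfl⟩
    exact (hD ▸ (⟨hx, y, hyD, rfl⟩ : T y ∈ D ∩ T '' D) : T y ∈ (∅ : Set X))
  refine (measureReal_mono hsub).trans_eq ?_
  rw [measureReal_def, measureReal_def, measure_iterImage hT]

end IterImage

/-! ### Upper Banach density -/

theorem maxCount_union_le (A B : Set ℤ) (N : ℕ) :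
    maxCount (A ∪ B) N ≤ maxCount A N + maxCount B N := by
  refine ciSup_le fun M => ?_
  have h : ((A ∪ B) ∩ Icc M (M + N - 1)).ncard ≤
      (A ∩ Icc M (M + N - 1)).ncard + (B ∩ Icc M (M + N - 1)).ncard := by
    rw [union_inter_distrib_right]
    exact ncard_union_le _ _
  calc (((A ∪ B) ∩ Icc M (M + N - 1)).ncard : ℝ)
      ≤ (A ∩ Icc M (M + N - 1)).ncard + (B ∩ Icc M (M + N - 1)).ncard := by exact_mod_cast h
    _ ≤ _ := add_le_add (le_ciSup (bddAbove_ncard A N) M) (le_ciSup (bddAbove_ncard B N) M)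

theorem upperBanachDensity_union_le (A B : Set ℤ) :
    upperBanachDensity (A ∪ B) ≤ upperBanachDensity A + upperBanachDensity B := by
  refine le_of_tendsto_of_tendsto' (tendsto_upperBanachDensity _)
    ((tendsto_upperBanachDensity A).add (tendsto_upperBanachDensity B)) fun N => ?_
  rw [← add_div]
  exact div_le_div_of_nonneg_right (maxCount_union_le A B N) N.cast_nonneg

theorem upperBanachDensity_empty : upperBanachDensity ∅ = 0 := by
  simp [upperBanachDensity, maxCount]

theorem exists_upperBanachDensity_pos_of_biUnion {ι : Type*} (s : Finset ι) (A : ι → Set ℤ)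
    (h : 0 < upperBanachDensity (⋃ i ∈ s, A i)) : ∃ i ∈ s, 0 < upperBanachDensity (A i) := by
  classical
  induction s using Finset.induction_on with
  | empty => simp [upperBanachDensity_empty] at h
  | insert a s _ ih =>
    rw [Finset.set_biUnion_insert] at h
    by_cases ha : 0 < upperBanachDensity (A a)
    · exact ⟨a, Finset.mem_insert_self _ _, ha⟩
    · obtain ⟨i, hi, hpos⟩ := ih (by linarith [upperBanachDensity_union_le (A a) (⋃ i ∈ s, A i)])
      exact ⟨i, Finset.mem_insert_of_mem hi, hpos⟩

/-- A set of positive upper Banach density has positive density inside a residue class. -/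
theorem exists_upperBanachDensity_inter_emod_pos {B : Set ℤ} (hB : 0 < upperBanachDensity B)
    {N : ℤ} (hN : 0 < N) : ∃ r : ℤ, 0 < upperBanachDensity (B ∩ {x | x % N = r}) := by
  obtain ⟨r, -, hr⟩ := exists_upperBanachDensity_pos_of_biUnion (Finset.Ico 0 N)
    (fun r => B ∩ {x | x % N = r}) (by
      convert hB using 2
      ext x
      simp only [mem_iUnion, mem_inter_iff, mem_ofPred_eq, Finset.mem_Ico, exists_prop]
      exact ⟨fun ⟨_, _, hx, _⟩ => hx,
        fun hx => ⟨x % N, ⟨Int.emod_nonneg _ hN.ne', Int.emod_lt_of_pos _ hN⟩, hx, rfl⟩⟩)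
  exact ⟨r, hr⟩

/-- The density is realized along a sequence of intervals with left end points `M N`. -/
theorem exists_intervals_upperBanachDensity (B : Set ℤ) :
    ∃ (M : ℕ → ℤ) (u : ℕ → ℝ), Tendsto u atTop (𝓝 (upperBanachDensity B)) ∧
      ∀ N : ℕ, u N ≤ ((B ∩ Icc (M N) (M N + N)).ncard : ℝ) / (N + 1) := by
  -- The supremum is only approached; the slack of 1 costs `1 / (N + 1)` in density, which vanishes
  -- in the limit.
  have h : ∀ N : ℕ, ∃ M : ℤ,
      maxCount B (N + 1) - 1 < ((B ∩ Icc M (M + (N + 1 : ℕ) - 1)).ncard : ℝ) := fun N =>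
    exists_lt_of_lt_ciSup (sub_one_lt _)
  choose M hM using h
  refine ⟨M, fun N => maxCount B (N + 1) / ((N + 1 : ℕ) : ℝ) - 1 / ((N : ℝ) + 1), ?_, fun N => ?_⟩
  · have h1 := (tendsto_upperBanachDensity B).comp (tendsto_add_atTop_nat 1)
    simpa using h1.sub (tendsto_one_div_add_atTop_nhds_zero_nat (𝕜 := ℝ))
  · have h2 := (hM N).le
    rw [show M N + ((N + 1 : ℕ) : ℤ) - 1 = M N + N by push_cast; ring] at h2
    push_cast
    rw [← sub_div]
    exact div_le_div_of_nonneg_right h2 (by positivity)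

/-! ### Limits of empirical measures -/

section Empirical

variable {Y : Type*} [TopologicalSpace Y] [CompactSpace Y] [T2Space Y] [MeasurableSpace Y]
  [BorelSpace Y]

/-- Along an ultrafilter, the empirical measures of a family of orbit segments converge weakly. -/
theorem exists_tendsto_empirical (x : ℤ → Y) (M : ℕ → ℤ) :
    ∃ (ν : ProbabilityMeasure Y) (U : Ultrafilter ℕ), (U : Filter ℕ) ≤ atTop ∧
      ∀ f : Y → ℝ, Continuous f →
        Tendsto (fun N : ℕ => (∑ i ∈ Finset.range (N + 1), f (x (M N + i))) / ((N : ℝ) + 1)) U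
          (𝓝 (∫ y, f y ∂(ν : Measure Y))) := by
  let m : ℕ → Measure Y := fun N =>
    ((N : ENNReal) + 1)⁻¹ • ∑ i ∈ Finset.range (N + 1), Measure.dirac (x (M N + i))
  have hm : ∀ N, IsProbabilityMeasure (m N) := fun N => ⟨by
    simp only [m, Measure.smul_apply, Measure.finsetSum_apply, measure_univ, Finset.sum_const,
      Finset.card_range, smul_eq_mul, nsmul_eq_mul, mul_one]
    push_cast
    exact ENNReal.inv_mul_cancel (by simp) (by simp)⟩
  let P : ℕ → ProbabilityMeasure Y := fun N => ⟨m N, hm N⟩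
  let U : Ultrafilter ℕ := Ultrafilter.of atTop
  -- Probability measures on a compact Hausdorff space are weakly compact.
  obtain ⟨ν, -, hν⟩ := isCompact_univ.ultrafilter_le_nhds (U.map P) (by simp)
  refine ⟨ν, U, Ultrafilter.of_le _, fun f hf => ?_⟩
  have h := (ProbabilityMeasure.tendsto_iff_forall_integral_tendsto.1
    (show Tendsto P U (𝓝 ν) from hν)) (BoundedContinuousFunction.mkOfCompact ⟨f, hf⟩)
  refine h.congr fun N => ?_
  change ∫ y, f y ∂(m N) = _
  have hint : ∀ a : Y, Integrable f (Measure.dirac a) := fun a =>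
    (BoundedContinuousFunction.mkOfCompact ⟨f, hf⟩).integrable _
  rw [integral_smul_measure, integral_finsetSum_measure fun i _ => hint _, div_eq_inv_mul]
  have hN : ((N : ENNReal) + 1)⁻¹.toReal = ((N : ℝ) + 1)⁻¹ := by
    rw [ENNReal.toReal_inv, ENNReal.toReal_add (by simp) (by simp)]
    simp
  rw [hN, smul_eq_mul]
  refine congrArg _ (Finset.sum_congr rfl fun i _ => ?_)
  exact integral_dirac' f _ hf.measurable.stronglyMeasurable

end Empirical

/-- A weak limit of empirical measures along an orbit is invariant. -/
theorem measurePreserving_of_tendsto_empirical {Y : Type*} [TopologicalSpace Y]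
    [MeasurableSpace Y] [BorelSpace Y] [HasOuterApproxClosed Y] {R : Y → Y}
    (hR : Continuous R) {x : ℤ → Y} (hx : ∀ i, x (i + 1) = R (x i)) {M : ℕ → ℤ}
    {ν : Measure Y} [IsProbabilityMeasure ν] {U : Ultrafilter ℕ} (hU : (U : Filter ℕ) ≤ atTop)
    (h : ∀ f : Y → ℝ, Continuous f →
      Tendsto (fun N : ℕ => (∑ i ∈ Finset.range (N + 1), f (x (M N + i))) / ((N : ℝ) + 1)) U
        (𝓝 (∫ y, f y ∂ν))) :
    MeasurePreserving R ν ν := by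
  refine ⟨hR.measurable, ?_⟩
  have := Measure.isProbabilityMeasure_map (μ := ν) hR.measurable.aemeasurable
  refine ext_of_forall_integral_eq_of_IsFiniteMeasure fun f => ?_
  rw [integral_map hR.measurable.aemeasurable f.continuous.aestronglyMeasurable]
  have hdiff := (h _ (f.continuous.comp hR)).sub (h _ f.continuous)
  refine sub_eq_zero.1 (tendsto_nhds_unique hdiff ?_)
  have hsq : Tendsto (fun N : ℕ => (2 * ‖f‖) * (1 / ((N : ℝ) + 1))) U (𝓝 0) := by
    simpa using (tendsto_one_div_add_atTop_nhds_zero_nat.const_mul (2 * ‖f‖)).mono_left hU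
  refine squeeze_zero_norm (fun N => ?_) hsq
  -- Shifting the orbit segment by one changes only its two end terms, an error of at most `2‖f‖ /
  -- (N + 1)`.
  have htel : ∑ i ∈ Finset.range (N + 1), (f ∘ R) (x (M N + i)) -
      ∑ i ∈ Finset.range (N + 1), f (x (M N + i)) =
      f (x (M N + (N + 1 : ℕ))) - f (x (M N + (0 : ℕ))) := by
    rw [← Finset.sum_sub_distrib, ← Finset.sum_range_sub (fun i : ℕ => f (x (M N + i)))]
    refine Finset.sum_congr rfl fun i _ => ?_
    rw [Function.comp_apply, ← hx]
    push_cast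
    rw [add_assoc]
  rw [← sub_div, htel, norm_div, Real.norm_of_nonneg (by positivity : (0 : ℝ) ≤ N + 1),
    mul_one_div]
  refine div_le_div_of_nonneg_right ?_ (by positivity)
  calc _ ≤ ‖f (x (M N + (N + 1 : ℕ)))‖ + ‖f (x (M N + (0 : ℕ)))‖ := norm_sub_le _ _
    _ ≤ 2 * ‖f‖ := by
      rw [two_mul]
      exact add_le_add (f.norm_coe_le_norm _) (f.norm_coe_le_norm _)

/-! ### The correspondence principle -/

/-- The two-sided shift on `ℤ → Bool`. -/
def boolShift : (ℤ → Bool) ≃ᵐ (ℤ → Bool) where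
  toFun x := fun j => x (j + 1)
  invFun x := fun j => x (j - 1)
  left_inv x := by ext j; simp
  right_inv x := by ext j; simp
  measurable_toFun := measurable_pi_lambda _ fun _ => measurable_pi_apply _
  measurable_invFun := measurable_pi_lambda _ fun _ => measurable_pi_apply _

theorem boolShift_apply (x : ℤ → Bool) (j : ℤ) : boolShift x j = x (j + 1) := rfl

theorem boolShift_zpow_apply (n : ℤ) (x : ℤ → Bool) (j : ℤ) :
    ((boolShift.toEquiv : Equiv.Perm (ℤ → Bool)) ^ n) x j = x (j + n) := by
  induction n using Int.induction_on generalizing x j with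
  | zero => simp
  | succ n ih =>
    rw [zpow_add, Equiv.Perm.mul_apply, ih]
    exact congrArg x (by ring)
  | pred n ih =>
    rw [zpow_sub, Equiv.Perm.mul_apply, ih]
    exact congrArg x (by ring)

theorem iterImage_boolShift_cylinder (n : ℤ) :
    iterImage boolShift n {x | x 0 = true} = {x | x (-n) = true} := by
  rw [iterImage, Equiv.image_eq_preimage_symm]
  ext x
  rw [← Equiv.Perm.inv_def, ← zpow_neg, mem_preimage, mem_ofPred_eq, boolShift_zpow_apply, zero_add,
    mem_ofPred_eq]

theorem isClopen_cylinder (n : ℤ) : IsClopen {x : ℤ → Bool | x n = true} :=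
  (isClopen_discrete {true}).preimage (continuous_apply n)

/-- Furstenberg's correspondence principle: a set of recurrence meets `B - B` whenever `B` has
positive upper Banach density. -/
theorem IsSetOfRecurrence.exists_mem_sub {S : Set ℤ} (hS : IsSetOfRecurrence S) {B : Set ℤ}
    (hB : 0 < upperBanachDensity B) : ∃ n ∈ S, n ∈ B - B := by
  classical
  obtain ⟨M, u, hu, huM⟩ := exists_intervals_upperBanachDensity B
  -- The orbit of the indicator of `B` under the shift.
  let x : ℤ → ℤ → Bool := fun i j => decide (j + i ∈ B)
  obtain ⟨ν, U, hU, hν⟩ := exists_tendsto_empirical x M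
  -- A clopen set has a continuous indicator, so weak convergence yields its measure.
  have hind : ∀ E : Set (ℤ → Bool), IsClopen E →
      Tendsto (fun N : ℕ => (∑ i ∈ Finset.range (N + 1),
        E.indicator (fun _ => (1 : ℝ)) (x (M N + i))) / ((N : ℝ) + 1)) U
        (𝓝 ((ν : Measure (ℤ → Bool)).real E)) := fun E hE => by
    have h := hν _ ((continuous_const (y := (1 : ℝ))).indicator (s := E) (by simp [hE.frontier_eq]))
    rwa [integral_indicator_const _ hE.isOpen.measurableSet, smul_eq_mul, mul_one] at h
  have hsys : IsSystem (ν : Measure (ℤ → Bool)) boolShift := by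
    refine ⟨inferInstance, measurePreserving_of_tendsto_empirical ?_ (x := x) ?_ hU hν⟩
    · exact continuous_pi fun j => continuous_apply (j + 1)
    · intro i
      ext j
      simp only [x, boolShift_apply, add_assoc, add_comm i 1]
  have hpos : 0 < (ν : Measure (ℤ → Bool)).real {x | x 0 = true} := by
    refine hB.trans_le (le_of_tendsto_of_tendsto' (hu.mono_left hU) (hind _ (isClopen_cylinder 0))
      fun N => (huM N).trans (div_le_div_of_nonneg_right ?_ (by positivity)))
    simp only [indicator_apply, mem_ofPred_eq, x, zero_add, decide_eq_true_eq]
    rw [Finset.sum_boole, Nat.cast_le]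
    have hsub : B ∩ Icc (M N) (M N + N) ⊆
        (fun i : ℕ => M N + (i : ℤ)) ''
          ((Finset.range (N + 1)).filter fun i : ℕ => M N + (i : ℤ) ∈ B) := by
      rintro b ⟨hb, h1, h2⟩
      refine ⟨(b - M N).toNat, ?_, by dsimp only; omega⟩
      rw [Finset.coe_filter, mem_ofPred_eq, Finset.mem_range]
      refine ⟨by omega, ?_⟩
      rwa [show M N + ((b - M N).toNat : ℤ) = b by omega]
    refine (ncard_le_ncard hsub ((Finset.finite_toSet _).image _)).trans ?_
    refine (ncard_image_le (Finset.finite_toSet _)).trans ?_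
    rw [ncard_coe_finset]
  obtain ⟨n, hn, hnpos⟩ := hS _ _ _ hsys {x | x 0 = true} (isClopen_cylinder 0).isOpen.measurableSet
    (by rw [measureReal_def] at hpos; exact (ENNReal.toReal_pos_iff.1 hpos).1)
  refine ⟨n, hn, ?_⟩
  rw [iterImage_boolShift_cylinder] at hnpos
  have hE := hind _ ((isClopen_cylinder 0).inter (isClopen_cylinder (-n)))
  have hE0 : 0 < (ν : Measure (ℤ → Bool)).real ({x | x 0 = true} ∩ {x | x (-n) = true}) :=
    ENNReal.toReal_pos hnpos.ne' (measure_ne_top _ _)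
  -- A positive limit forces a nonzero term in some empirical sum: a point of `B` whose translate by
  -- `-n` is also in `B`.
  obtain ⟨N, hN⟩ := (hE.eventually (lt_mem_nhds hE0)).exists
  obtain ⟨i, -, hi⟩ := Finset.exists_ne_zero_of_sum_ne_zero
    (fun h0 => by rw [h0, zero_div] at hN; exact lt_irrefl _ hN)
  have hmem := mem_of_indicator_ne_zero hi
  simp only [x, mem_inter_iff, mem_ofPred_eq, decide_eq_true_eq, zero_add] at hmem
  exact ⟨_, hmem.1, _, hmem.2, by dsimp only; ring⟩

/-- A version of `IsSetOfRecurrence.exists_mem_sub` avoiding finitely many nonzero times. -/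
theorem IsSetOfRecurrence.exists_mem_sub_notMem {S : Set ℤ} (hS : IsSetOfRecurrence S) {B : Set ℤ}
    (hB : 0 < upperBanachDensity B) {F : Set ℤ} (hF : F.Finite) (h0 : (0 : ℤ) ∉ F) :
    ∃ n ∈ S, n ∈ B - B ∧ n ∉ F := by
  obtain ⟨K, hK⟩ := (hF.image abs).bddAbove
  have hK' : ∀ f ∈ F, |f| ≤ K := fun f hf => hK ⟨f, hf, rfl⟩
  -- Within one residue class modulo `|K| + 1`, every nonzero difference exceeds all of `F` in
  -- absolute value.
  have hN : 0 < |K| + 1 := by positivity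
  obtain ⟨r, hr⟩ := exists_upperBanachDensity_inter_emod_pos hB hN
  obtain ⟨n, hn, a, ⟨ha, har⟩, b, ⟨hb, hbr⟩, rfl⟩ := hS.exists_mem_sub hr
  refine ⟨_, hn, ⟨a, ha, b, hb, rfl⟩, fun hf => ?_⟩
  have hdvd : |K| + 1 ∣ a - b :=
    Int.ModEq.dvd (show b % (|K| + 1) = a % (|K| + 1) from hbr.trans har.symm)
  have hz : a - b = 0 := Int.eq_zero_of_abs_lt_dvd hdvd
    (by have := hK' _ hf; dsimp only at this; linarith [le_abs_self K])
  dsimp only at hf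
  exact h0 (hz ▸ hf)

/-! ### Rigidity against recurrence -/

theorem proposition3p5 {X : Type*} [MeasurableSpace X] (μ : Measure X) (T : X ≃ᵐ X)
    (hnontrivial : IsNontrivialSystem μ) (hX : IsRigidRecurrenceSystem μ T)
    (D : Set X) (hD : MeasurableSet D) (hdisj : D ∩ T '' D = ∅)
    (c : ℝ) (hc : 0 < c) :
    ¬ ∃ (n₀ : ℤ) (B : Set ℤ), 0 < upperBanachDensity B ∧
      {n₀} + (B - B) ⊆ popularRecurrenceSet μ T c D := by
  rintro ⟨n₀, B, hB, hsub⟩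
  obtain ⟨hsys, S, hS, hrec⟩ := hX
  have := hsys.isProbabilityMeasure
  have hT := hsys.measurePreserving
  -- Two rigidity errors, from `s` and `s₀`, are added, so each is allowed `c / 2`.
  set F : Set ℤ := {n | n ∈ S ∧ c / 2 < μ.real (D ∆ iterImage T n D)} with hFdef
  have hF : F.Finite := hS.rigid D hD (c / 2) (half_pos hc)
  have hgood : ∀ s ∈ S, s ∉ F → μ.real (D ∆ iterImage T s D) ≤ c / 2 := fun s hs hsF =>
    not_lt.1 fun h => hsF ⟨hs, h⟩
  -- The rigidity time `s₀` keeps the exceptional times away from `0`.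
  obtain ⟨s₀, hs₀, hs₀F⟩ := hS.infinite.exists_notMem_finite
    (hF.union (hF.image fun f => n₀ - 1 - f))
  rw [mem_union, not_or] at hs₀F
  -- The shift makes `n₀ + (s + (1 - n₀ + s₀))` equal to `1 + (s + s₀)`.
  obtain ⟨_, ⟨s, hs, rfl⟩, hsB, hsF⟩ := (hrec (1 - n₀ + s₀)).exists_mem_sub_notMem hB
    (hF.image fun f => f + (1 - n₀ + s₀))
    (by rintro ⟨f, hf, h⟩; exact hs₀F.2 ⟨f, hf, by dsimp only at h ⊢; linarith⟩)
  have hsF' : s ∉ F := fun h => hsF ⟨s, h, rfl⟩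
  have hmem : 1 + (s + s₀) ∈ popularRecurrenceSet μ T c D :=
    hsub ⟨n₀, rfl, _, hsB, by dsimp only; ring⟩
  have h1 : c < μ.real (D ∩ iterImage T (1 + (s + s₀)) D) := hmem
  have h2 := measureReal_inter_iterImage_one_add_le hT hdisj (s + s₀)
  have h3 := measureReal_symmDiff_iterImage_add_le hT s s₀ D
  linarith [hgood s hs hsF', hgood s₀ hs₀ hs₀F.1]
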